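/- For integers $m,n\ge k\ge 1$, a real $m\times n$ matrix is called sign regular of order $k$ (SR$_k$) if for every $1\le r\le k$ there is a sign $\epsilon_r\in\{1,-1\}$ such that every nonzero $r\times r$ minor of it has sign $\epsilon_r$, and strictly sign regular of order $k$ (SSR$_k$) if for every $1\le r\le k$ there is a sign $\epsilon_r\in\{1,-1\}$ such that every $r\times r$ minor of it is nonzero and has sign $\epsilon_r$. It is sign regular (SR), respectively strictly sign regular (SSR), if this holds with $k=\min\{m,n\}$. Let $P_n$ denote the $n\times n$ exchange matrix, which has ones on the antidiagonal and zeros elsewhere. **Theorem A.** Let $\mathcal L:\mathbb R^{m\times n}\to\mathbb R^{m\times n}$ be a linear transformation, where either $m=n\ge 3$, or $m\ne n$ and $m,n\ge 2$. Then the following statements are equivalent. 1. $\mathcal L$ maps the class of SR $m\times n$ matrices onto itself, i.e. $\mathcal L(\mathrm{SR})=\mathrm{SR}$. 2. $\mathcal L$ maps the class of SR$_2$ $m\times n$ matrices onto itself, i.e. $\mathcal L(\mathrm{SR}_2)=\mathrm{SR}_2$. 3. $\mathcal L$ is a composition of one or more transformations, each of one of the following types: (a) $A\mapsto FAE$, where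 $F\in\mathbb R^{m\times m}$ and $E\in\mathbb R^{n\times n}$ are diagonal matrices with positive diagonal entries; (b) $A\mapsto -A$; (c) $A\mapsto P_mA$; (d) $A\mapsto AP_n$; (e) $A\mapsto A^T$, provided $m=n$. Moreover, the three statements are also equivalent when SR and SR$_2$ are replaced by SSR and SSR$_2$, respectively, in (1) and (2), with (3) unchanged. -/

import Mathlib

/-- The `r × r` minor of `A` in the rows `f 0 < f 1 < ⋯` and the columns `g 0 < g 1 < ⋯`. -/
noncomputable def matrixMinor {m n r : ℕ} (A : Matrix (Fin m) (Fin n) ℝ)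
    (f : Fin r ↪o Fin m) (g : Fin r ↪o Fin n) : ℝ :=
  (A.submatrix f g).det

/-- The real `m × n` matrices that are sign regular of order `k` (`SR_k`): for every
`1 ≤ r ≤ k` there is a sign `ε` such that every nonzero `r × r` minor has sign `ε`. -/
def signRegularOfOrder (m n k : ℕ) : Set (Matrix (Fin m) (Fin n) ℝ) :=
  {A | ∀ r : ℕ, 1 ≤ r → r ≤ k → ∃ ε : ℝ, (ε = 1 ∨ ε = -1) ∧
    ∀ (f : Fin r ↪o Fin m) (g : Fin r ↪o Fin n), 0 ≤ ε * matrixMinor A f g}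

/-- The real `m × n` matrices that are strictly sign regular of order `k` (`SSR_k`): for every
`1 ≤ r ≤ k` there is a sign `ε` such that every `r × r` minor is nonzero of sign `ε`. -/
def strictlySignRegularOfOrder (m n k : ℕ) : Set (Matrix (Fin m) (Fin n) ℝ) :=
  {A | ∀ r : ℕ, 1 ≤ r → r ≤ k → ∃ ε : ℝ, (ε = 1 ∨ ε = -1) ∧
    ∀ (f : Fin r ↪o Fin m) (g : Fin r ↪o Fin n), 0 < ε * matrixMinor A f g}

/-- The sign regular `m × n` matrices. -/
def signRegular (m n : ℕ) : Set (Matrix (Fin m) (Fin n) ℝ) :=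
  signRegularOfOrder m n (min m n)

/-- The strictly sign regular `m × n` matrices. -/
def strictlySignRegular (m n : ℕ) : Set (Matrix (Fin m) (Fin n) ℝ) :=
  strictlySignRegularOfOrder m n (min m n)

/-- The exchange matrix `P_n`: ones on the antidiagonal, zeros elsewhere. -/
def exchangeMatrix (n : ℕ) : Matrix (Fin n) (Fin n) ℝ :=
  Matrix.of fun i j => if j = Fin.rev i then 1 else 0

/-- The basic linear transformations of `m × n` matrices. In the last one `m = n`, and the
matrix on the right is the transpose of `A`, with its index types identified along `m = n`. -/
inductive IsBasicTransformation {m n : ℕ}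
    (T : Matrix (Fin m) (Fin n) ℝ →ₗ[ℝ] Matrix (Fin m) (Fin n) ℝ) : Prop
  | diagonalEquivalence (F : Fin m → ℝ) (E : Fin n → ℝ) (hF : ∀ i, 0 < F i) (hE : ∀ j, 0 < E j)
      (hT : ∀ A, T A = Matrix.diagonal F * A * Matrix.diagonal E)
  | negation (hT : ∀ A, T A = -A)
  | exchangeRows (hT : ∀ A, T A = exchangeMatrix m * A)
  | exchangeColumns (hT : ∀ A, T A = A * exchangeMatrix n)
  | transposition (h : m = n)
      (hT : ∀ A, T A = A.transpose.submatrix (Fin.cast h) (Fin.cast h.symm))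

/-- Compositions of one or more basic transformations. -/
inductive IsCompositionOfBasic {m n : ℕ} :
    (Matrix (Fin m) (Fin n) ℝ →ₗ[ℝ] Matrix (Fin m) (Fin n) ℝ) → Prop
  | basic {T : Matrix (Fin m) (Fin n) ℝ →ₗ[ℝ] Matrix (Fin m) (Fin n) ℝ}
      (hT : IsBasicTransformation T) : IsCompositionOfBasic T
  | comp {S T : Matrix (Fin m) (Fin n) ℝ →ₗ[ℝ] Matrix (Fin m) (Fin n) ℝ}
      (hS : IsCompositionOfBasic S) (hT : IsCompositionOfBasic T) :
      IsCompositionOfBasic (S ∘ₗ T)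

/-!
Linear maps preserving sign regularity.

Compositions of basic transformations preserve each class because a basic transformation sends
minors to minors of the same order, up to a positive factor and a sign that depends only on the
order (`IsBasicTransformation.exists_matrixMinor_eq`), and because its inverse is basic again.

For the converse, all four classes lie between `SSR` and `SR₂`, and only this and the stability
under basic transformations are used (`isCompositionOfBasic_of_image_eq`). Such a map `L` is
bijective, and up to a common sign both `L` and its inverse are entrywise nonnegative
(`exists_sign_nonneg`), so `L` permutes the matrix units up to positive factors
(`exists_perm_of_nonneg`): `L A i j = ± c i j * A (σ (i, j))` with all `c i j` positive.

Now pass to logarithms. A positive matrix `exp x` is in `SR₂` if and only if `x` or `-x` is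
supermodular; let `S` be the set of these `x`. The higher minors disappear asymptotically: if `x` or
`-x` is strictly supermodular, then `exp (t • x)` is in `SSR` for large `t`, since one term of the
Leibniz formula dominates (`IsStrictlySupermodular.eventually_det_pos`). In logarithmic coordinates
`L` is the permutation `σ` of the entries followed by the translation by `log c`. Letting `t` tend
to infinity shows that `σ` preserves `S` (`permuteEntries_mem`). The translations that preserve `S`
are those by the modular matrices `x i j = r i + s j` (`isModular_of_forall_add_mem`); this is where
`2 × 2` matrices have to be excluded. Hence `σ` preserves modularity, so it permutes rows and
columns separately, or exchanges them, and testing with `x i j = i * j` shows that it only reverses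
orders (`exists_isCompositionOfBasic_permuteEntries`). After composing with these transformations
`σ` is the identity, and iterating `L` shows that translation by `log c` preserves `S`
(`isModular_log`). So `log c` is modular and `L` is, up to sign, a diagonal scaling.
-/

open Filter Topology

/-! ### Basic transformations act on the sign regular classes -/

theorem exchangeMatrix_mul_apply {m n : ℕ} (A : Matrix (Fin m) (Fin n) ℝ) (i : Fin m) (j : Fin n) :
    (exchangeMatrix m * A) i j = A i.rev j := by
  simp [exchangeMatrix, Matrix.mul_apply]

theorem mul_exchangeMatrix_apply {m n : ℕ} (A : Matrix (Fin m) (Fin n) ℝ) (i : Fin m) (j : Fin n) :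
    (A * exchangeMatrix n) i j = A i j.rev := by
  have h : ∀ k : Fin n, (j = k.rev) ↔ (k = j.rev) := fun k =>
    ⟨fun h => by rw [h, Fin.rev_rev], fun h => by rw [h, Fin.rev_rev]⟩
  simp [exchangeMatrix, Matrix.mul_apply, h]

/-- The linear map `A ↦ diagonal F * A * diagonal E`. -/
def diagonalScaling {m n : ℕ} (F : Fin m → ℝ) (E : Fin n → ℝ) :
    Matrix (Fin m) (Fin n) ℝ →ₗ[ℝ] Matrix (Fin m) (Fin n) ℝ where
  toFun A := Matrix.of fun i j => F i * A i j * E j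
  map_add' A B := by ext i j; simp; ring
  map_smul' c A := by ext i j; simp; ring

@[simp] theorem diagonalScaling_apply {m n : ℕ} (F : Fin m → ℝ) (E : Fin n → ℝ)
    (A : Matrix (Fin m) (Fin n) ℝ) (i : Fin m) (j : Fin n) :
    diagonalScaling F E A i j = F i * A i j * E j := rfl

theorem isBasicTransformation_diagonalScaling {m n : ℕ} {F : Fin m → ℝ} {E : Fin n → ℝ}
    (hF : ∀ i, 0 < F i) (hE : ∀ j, 0 < E j) : IsBasicTransformation (diagonalScaling F E) :=
  .diagonalEquivalence F E hF hE fun A => by ext i j; simp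

/-- Conjugating an increasing selection of indices by reversal gives an increasing selection. -/
def revConj {r m : ℕ} (f : Fin r ↪o Fin m) : Fin r ↪o Fin m :=
  OrderEmbedding.ofStrictMono (fun i => (f i.rev).rev) fun i j hij => by simpa using hij

@[simp] theorem revConj_apply {r m : ℕ} (f : Fin r ↪o Fin m) (i : Fin r) :
    revConj f i = (f i.rev).rev := rfl

/-- Up to a sign depending only on the order and up to a positive factor, a minor of the image of
`A` under a basic transformation is a minor of `A`. -/
theorem IsBasicTransformation.exists_matrixMinor_eq {m n : ℕ}
    {T : Matrix (Fin m) (Fin n) ℝ →ₗ[ℝ] Matrix (Fin m) (Fin n) ℝ}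
    (hT : IsBasicTransformation T) (r : ℕ) :
    ∃ δ : ℝ, (δ = 1 ∨ δ = -1) ∧ ∀ A (f : Fin r ↪o Fin m) (g : Fin r ↪o Fin n),
      ∃ c : ℝ, 0 < c ∧ ∃ (f' : Fin r ↪o Fin m) (g' : Fin r ↪o Fin n),
        matrixMinor (T A) f g = δ * c * matrixMinor A f' g' := by
  have hsign : ((Equiv.Perm.sign (Fin.revPerm (n := r)) : ℤ) : ℝ) = 1 ∨
      ((Equiv.Perm.sign (Fin.revPerm (n := r)) : ℤ) : ℝ) = -1 := by
    rcases Int.units_eq_one_or (Equiv.Perm.sign (Fin.revPerm (n := r))) with h | h <;> simp [h]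
  cases hT with
  | diagonalEquivalence F E hF hE hT =>
    refine ⟨1, Or.inl rfl, fun A f g => ⟨(∏ i, F (f i)) * ∏ j, E (g j), by
      have h₁ : 0 < ∏ i, F (f i) := Finset.prod_pos fun i _ => hF _
      have h₂ : 0 < ∏ j, E (g j) := Finset.prod_pos fun i _ => hE _
      positivity, f, g, ?_⟩⟩
    have h : (T A).submatrix f g = Matrix.diagonal (fun i => F (f i)) * A.submatrix f g *
        Matrix.diagonal (fun j => E (g j)) := by
      ext i j
      simp [hT]
    rw [matrixMinor, matrixMinor, h, Matrix.det_mul, Matrix.det_mul, Matrix.det_diagonal,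
      Matrix.det_diagonal]
    ring
  | negation hT =>
    refine ⟨(-1) ^ r, neg_one_pow_eq_or ℝ r, fun A f g => ⟨1, one_pos, f, g, ?_⟩⟩
    have h : (T A).submatrix f g = -A.submatrix f g := by
      ext i j
      simp [hT]
    rw [matrixMinor, matrixMinor, h, Matrix.det_neg, Fintype.card_fin]
    ring
  | exchangeRows hT =>
    refine ⟨_, hsign, fun A f g => ⟨1, one_pos, revConj f, g, ?_⟩⟩
    have h : (T A).submatrix f g = (A.submatrix (revConj f) g).submatrix Fin.revPerm id := by
      ext i j
      simp [hT, exchangeMatrix_mul_apply]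
    rw [matrixMinor, matrixMinor, h, Matrix.det_permute, mul_one]
  | exchangeColumns hT =>
    refine ⟨_, hsign, fun A f g => ⟨1, one_pos, f, revConj g, ?_⟩⟩
    have h : (T A).submatrix f g = (A.submatrix f (revConj g)).submatrix id Fin.revPerm := by
      ext i j
      simp [hT, mul_exchangeMatrix_apply]
    rw [matrixMinor, matrixMinor, h, Matrix.det_permute', mul_one]
  | transposition h hT =>
    refine ⟨1, Or.inl rfl, fun A f g => ⟨1, one_pos,
      g.trans (Fin.castOrderIso h.symm).toOrderEmbedding,
      f.trans (Fin.castOrderIso h).toOrderEmbedding, ?_⟩⟩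
    have h' : (T A).submatrix f g = (A.submatrix
        (g.trans (Fin.castOrderIso h.symm).toOrderEmbedding)
        (f.trans (Fin.castOrderIso h).toOrderEmbedding)).transpose := by
      ext i j
      simp [hT]
    rw [matrixMinor, matrixMinor, h', Matrix.det_transpose]
    ring

theorem IsBasicTransformation.mapsTo_signRegularOfOrder {m n : ℕ}
    {T : Matrix (Fin m) (Fin n) ℝ →ₗ[ℝ] Matrix (Fin m) (Fin n) ℝ}
    (hT : IsBasicTransformation T) (k : ℕ) :
    Set.MapsTo T (signRegularOfOrder m n k) (signRegularOfOrder m n k) := by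
  intro A hA r hr hrk
  obtain ⟨ε, hε, h⟩ := hA r hr hrk
  obtain ⟨δ, hδ, hm⟩ := hT.exists_matrixMinor_eq r
  refine ⟨ε * δ, by rcases hε with rfl | rfl <;> rcases hδ with rfl | rfl <;> simp, fun f g => ?_⟩
  obtain ⟨c, hc, f', g', e⟩ := hm A f g
  have hδ2 : δ * δ = 1 := by rcases hδ with rfl | rfl <;> norm_num
  have : ε * δ * matrixMinor (T A) f g = c * (ε * matrixMinor A f' g') := by
    rw [e]; linear_combination (ε * c * matrixMinor A f' g') * hδ2
  rw [this]
  exact mul_nonneg hc.le (h f' g')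

theorem IsBasicTransformation.mapsTo_strictlySignRegularOfOrder {m n : ℕ}
    {T : Matrix (Fin m) (Fin n) ℝ →ₗ[ℝ] Matrix (Fin m) (Fin n) ℝ}
    (hT : IsBasicTransformation T) (k : ℕ) :
    Set.MapsTo T (strictlySignRegularOfOrder m n k) (strictlySignRegularOfOrder m n k) := by
  intro A hA r hr hrk
  obtain ⟨ε, hε, h⟩ := hA r hr hrk
  obtain ⟨δ, hδ, hm⟩ := hT.exists_matrixMinor_eq r
  refine ⟨ε * δ, by rcases hε with rfl | rfl <;> rcases hδ with rfl | rfl <;> simp, fun f g => ?_⟩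
  obtain ⟨c, hc, f', g', e⟩ := hm A f g
  have hδ2 : δ * δ = 1 := by rcases hδ with rfl | rfl <;> norm_num
  have : ε * δ * matrixMinor (T A) f g = c * (ε * matrixMinor A f' g') := by
    rw [e]; linear_combination (ε * c * matrixMinor A f' g') * hδ2
  rw [this]
  exact mul_pos hc (h f' g')

theorem IsBasicTransformation.exists_inverse {m n : ℕ}
    {T : Matrix (Fin m) (Fin n) ℝ →ₗ[ℝ] Matrix (Fin m) (Fin n) ℝ}
    (hT : IsBasicTransformation T) :
    ∃ T' : Matrix (Fin m) (Fin n) ℝ →ₗ[ℝ] Matrix (Fin m) (Fin n) ℝ,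
      IsBasicTransformation T' ∧ (∀ A, T (T' A) = A) ∧ ∀ A, T' (T A) = A := by
  have involutive (h : ∀ A, T (T A) = A) :
      ∃ T' : Matrix (Fin m) (Fin n) ℝ →ₗ[ℝ] Matrix (Fin m) (Fin n) ℝ,
        IsBasicTransformation T' ∧ (∀ A, T (T' A) = A) ∧ ∀ A, T' (T A) = A := ⟨T, hT, h, h⟩
  cases hT with
  | diagonalEquivalence F E hF hE hT =>
    refine ⟨diagonalScaling F⁻¹ E⁻¹, isBasicTransformation_diagonalScaling
      (fun i => inv_pos.2 (hF i)) (fun j => inv_pos.2 (hE j)), fun A => ?_, fun A => ?_⟩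
    all_goals
      ext i j
      have h₁ := (hF i).ne'
      have h₂ := (hE j).ne'
      simp only [hT, diagonalScaling_apply, Matrix.mul_diagonal,
        Matrix.diagonal_mul, Pi.inv_apply]
      field_simp
  | negation hT => exact involutive fun A => by simp [hT]
  | exchangeRows hT =>
    exact involutive fun A => by ext i j; simp [hT, exchangeMatrix_mul_apply]
  | exchangeColumns hT =>
    exact involutive fun A => by ext i j; simp [hT, mul_exchangeMatrix_apply]
  | transposition h hT =>
    exact involutive fun A => by ext i j; simp [hT]

theorem IsCompositionOfBasic.exists_inverse {m n : ℕ}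
    {T : Matrix (Fin m) (Fin n) ℝ →ₗ[ℝ] Matrix (Fin m) (Fin n) ℝ}
    (hT : IsCompositionOfBasic T) :
    ∃ T' : Matrix (Fin m) (Fin n) ℝ →ₗ[ℝ] Matrix (Fin m) (Fin n) ℝ,
      IsCompositionOfBasic T' ∧ (∀ A, T (T' A) = A) ∧ ∀ A, T' (T A) = A := by
  induction hT with
  | basic h =>
    obtain ⟨T', h', h₁, h₂⟩ := h.exists_inverse
    exact ⟨T', .basic h', h₁, h₂⟩
  | comp _ _ ihS ihT =>
    obtain ⟨S', hS', hS₁, hS₂⟩ := ihS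
    obtain ⟨T', hT', hT₁, hT₂⟩ := ihT
    exact ⟨T' ∘ₗ S', .comp hT' hS', fun A => by simp [hT₁, hS₁], fun A => by simp [hT₂, hS₂]⟩

/-- A class stable under the basic transformations is mapped onto itself by their compositions,
since the inverse of a basic transformation is basic. -/
theorem IsCompositionOfBasic.image_eq {m n : ℕ} {C : Set (Matrix (Fin m) (Fin n) ℝ)}
    (hC : ∀ B, IsBasicTransformation B → Set.MapsTo B C C)
    {T : Matrix (Fin m) (Fin n) ℝ →ₗ[ℝ] Matrix (Fin m) (Fin n) ℝ}
    (hT : IsCompositionOfBasic T) : T '' C = C := by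
  induction hT with
  | basic h =>
    obtain ⟨T', h', h₁, -⟩ := h.exists_inverse
    exact (hC _ h).image_subset.antisymm fun A hA => ⟨T' A, hC _ h' hA, h₁ A⟩
  | @comp S T _ _ ihS ihT => rw [LinearMap.coe_comp, Set.image_comp, ihT, ihS]

theorem signRegularOfOrder_anti {m n k l : ℕ} (h : k ≤ l) :
    signRegularOfOrder m n l ⊆ signRegularOfOrder m n k :=
  fun _ hA r hr hrk => hA r hr (hrk.trans h)

theorem strictlySignRegularOfOrder_anti {m n k l : ℕ} (h : k ≤ l) :
    strictlySignRegularOfOrder m n l ⊆ strictlySignRegularOfOrder m n k :=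
  fun _ hA r hr hrk => hA r hr (hrk.trans h)

theorem strictlySignRegularOfOrder_subset {m n k : ℕ} :
    strictlySignRegularOfOrder m n k ⊆ signRegularOfOrder m n k := fun _ hA r hr hrk =>
  let ⟨ε, hε, h⟩ := hA r hr hrk
  ⟨ε, hε, fun f g => (h f g).le⟩

theorem entries_nonneg_or_nonpos_of_mem_signRegularOfOrder {m n : ℕ}
    {A : Matrix (Fin m) (Fin n) ℝ} (hA : A ∈ signRegularOfOrder m n 2) :
    (∀ i j, 0 ≤ A i j) ∨ ∀ i j, A i j ≤ 0 := by
  obtain ⟨ε, hε, h⟩ := hA 1 le_rfl one_le_two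
  have key : ∀ i j, 0 ≤ ε * A i j := fun i j => by
    simpa [matrixMinor] using h
      (OrderEmbedding.ofStrictMono (fun _ => i) (Subsingleton.strictMono _))
      (OrderEmbedding.ofStrictMono (fun _ => j) (Subsingleton.strictMono _))
  rcases hε with rfl | rfl
  · exact Or.inl fun i j => by simpa using key i j
  · exact Or.inr fun i j => by simpa using key i j

theorem det_two_nonneg_or_nonpos_of_mem_signRegularOfOrder {m n : ℕ}
    {A : Matrix (Fin m) (Fin n) ℝ} (hA : A ∈ signRegularOfOrder m n 2) :
    (∀ i k, i < k → ∀ j l, j < l → A i l * A k j ≤ A i j * A k l) ∨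
      ∀ i k, i < k → ∀ j l, j < l → A i j * A k l ≤ A i l * A k j := by
  obtain ⟨ε, hε, h⟩ := hA 2 one_le_two le_rfl
  have key : ∀ i k, i < k → ∀ j l, j < l → 0 ≤ ε * (A i j * A k l - A i l * A k j) := by
    intro i k hik j l hjl
    have hmono {N : ℕ} {a b : Fin N} (hab : a < b) : StrictMono ![a, b] := by
      intro p q hpq
      fin_cases p <;> fin_cases q <;> simp_all
    have := h (OrderEmbedding.ofStrictMono _ (hmono hik)) (OrderEmbedding.ofStrictMono _ (hmono hjl))
    rw [matrixMinor, Matrix.det_fin_two] at this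
    exact this
  rcases hε with rfl | rfl
  · exact Or.inl fun i k hik j l hjl => by linarith [key i k hik j l hjl]
  · exact Or.inr fun i k hik j l hjl => by linarith [key i k hik j l hjl]

/-! ### Supermodular exponents give strictly sign regular matrices -/

/-- A matrix `x` is supermodular (an inverse Monge matrix) if `x i l + x k j ≤ x i j + x k l`
for `i < k` and `j < l`; for a positive matrix `A`, this says that the `2 × 2` minors of `A`
are nonnegative, where `x` is the entrywise logarithm of `A`. -/
def IsSupermodular {m n : ℕ} (x : Matrix (Fin m) (Fin n) ℝ) : Prop :=
  ∀ i k, i < k → ∀ j l, j < l → x i l + x k j ≤ x i j + x k l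

/-- Supermodularity with strict inequalities. -/
def IsStrictlySupermodular {m n : ℕ} (x : Matrix (Fin m) (Fin n) ℝ) : Prop :=
  ∀ i k, i < k → ∀ j l, j < l → x i l + x k j < x i j + x k l

/-- The entrywise exponential of `t • x`. -/
noncomputable def expMatrix {m n : ℕ} (t : ℝ) (x : Matrix (Fin m) (Fin n) ℝ) :
    Matrix (Fin m) (Fin n) ℝ :=
  Matrix.of fun i j => Real.exp (t * x i j)

@[simp] theorem expMatrix_apply {m n : ℕ} (t : ℝ) (x : Matrix (Fin m) (Fin n) ℝ) (i : Fin m)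
    (j : Fin n) : expMatrix t x i j = Real.exp (t * x i j) := rfl

theorem perm_eq_one_of_strictMono {r : ℕ} {π : Equiv.Perm (Fin r)} (h : StrictMono π) :
    π = 1 := by
  have : StrictMono.orderIsoOfSurjective π h π.surjective = OrderIso.refl _ :=
    Subsingleton.elim _ _
  ext i
  exact congrArg (fun e : Fin r ≃o Fin r => ((e i : Fin r) : ℕ)) this

/-- The optimal assignment for a strictly supermodular matrix is the diagonal one, and no other:
exchanging two values of `π` at an inversion increases the sum. -/
theorem IsStrictlySupermodular.sum_perm_lt {r : ℕ} {y : Matrix (Fin r) (Fin r) ℝ}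
    (hy : IsStrictlySupermodular y) {π : Equiv.Perm (Fin r)} (hπ : π ≠ 1) :
    ∑ i, y (π i) i < ∑ i, y i i := by
  have unique_max : ∀ π : Equiv.Perm (Fin r),
      (∀ τ : Equiv.Perm (Fin r), ∑ i, y (τ i) i ≤ ∑ i, y (π i) i) → π = 1 := by
    intro π hmax
    refine perm_eq_one_of_strictMono fun i k hik => ?_
    by_contra! hle
    have hlt : π k < π i := lt_of_le_of_ne hle fun h => hik.ne' (π.injective h)
    have hsum : ∑ a, (y ((π * Equiv.swap i k) a) a - y (π a) a) =
        (y (π k) i - y (π i) i) + (y (π i) k - y (π k) k) := by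
      rw [Fintype.sum_eq_add i k hik.ne]
      · simp
      · rintro a ⟨h₁, h₂⟩
        simp [Equiv.swap_apply_of_ne_of_ne h₁ h₂]
    rw [Finset.sum_sub_distrib] at hsum
    have := hy _ _ hlt _ _ hik
    have := hmax (π * Equiv.swap i k)
    linarith
  obtain ⟨π₀, hπ₀⟩ := Finite.exists_max fun τ : Equiv.Perm (Fin r) => ∑ i, y (τ i) i
  obtain rfl := unique_max π₀ hπ₀
  by_contra! h
  exact hπ (unique_max π fun τ => (hπ₀ τ).trans h)

/-- For large `t` the diagonal term dominates the Leibniz expansion of the determinant. -/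
theorem IsStrictlySupermodular.eventually_det_pos {r : ℕ} {y : Matrix (Fin r) (Fin r) ℝ}
    (hy : IsStrictlySupermodular y) : ∀ᶠ t in atTop, 0 < (expMatrix t y).det := by
  have hdet : ∀ t, (expMatrix t y).det * Real.exp (-(t * ∑ i, y i i)) =
      ∑ π : Equiv.Perm (Fin r), (Equiv.Perm.sign π : ℝ) *
        Real.exp (t * (∑ i, y (π i) i - ∑ i, y i i)) := by
    intro t
    rw [Matrix.det_apply', Finset.sum_mul]
    refine Finset.sum_congr rfl fun π _ => ?_
    simp only [expMatrix_apply]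
    rw [← Real.exp_sum, mul_assoc, ← Real.exp_add, ← Finset.mul_sum]
    congr 2
    ring
  have hlim : Tendsto (fun t => (expMatrix t y).det * Real.exp (-(t * ∑ i, y i i))) atTop
      (𝓝 (∑ π : Equiv.Perm (Fin r), if π = 1 then 1 else 0)) := by
    simp only [hdet]
    refine tendsto_finsetSum _ fun π _ => ?_
    split_ifs with h
    · subst h
      simp
    · have hneg : ∑ i, y (π i) i - ∑ i, y i i < 0 := sub_neg.2 (hy.sum_perm_lt h)
      simpa using (Real.tendsto_exp_atBot.comp
        (tendsto_id.atTop_mul_const_of_neg hneg)).const_mul (Equiv.Perm.sign π : ℝ)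
  rw [Finset.sum_ite_eq' Finset.univ, if_pos (Finset.mem_univ _)] at hlim
  filter_upwards [hlim.eventually_const_lt one_pos] with t ht
  exact pos_of_mul_pos_left ht (Real.exp_pos _).le

theorem IsStrictlySupermodular.eventually_mem {m n : ℕ} {x : Matrix (Fin m) (Fin n) ℝ}
    (hx : IsStrictlySupermodular x) :
    ∀ᶠ t in atTop, expMatrix t x ∈ strictlySignRegular m n := by
  have h : ∀ᶠ t in atTop, ∀ r : Fin (min m n + 1), ∀ (f : Fin r ↪o Fin m) (g : Fin r ↪o Fin n),
      0 < matrixMinor (expMatrix t x) f g := by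
    refine eventually_all.2 fun r => eventually_all.2 fun f => eventually_all.2 fun g => ?_
    have hy : IsStrictlySupermodular (x.submatrix f g) := fun i k hik j l hjl =>
      hx _ _ (f.strictMono hik) _ _ (g.strictMono hjl)
    exact hy.eventually_det_pos
  filter_upwards [h] with t ht r _ hr
  exact ⟨1, Or.inl rfl, fun f g => by simpa using ht ⟨r, Nat.lt_succ_of_le hr⟩ f g⟩

/-- If `-x` is strictly supermodular, then so is `x` with the order of its columns reversed. -/
theorem IsStrictlySupermodular.eventually_mem_of_neg {m n : ℕ} {x : Matrix (Fin m) (Fin n) ℝ}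
    (hx : IsStrictlySupermodular (-x)) :
    ∀ᶠ t in atTop, expMatrix t x ∈ strictlySignRegular m n := by
  have hy : IsStrictlySupermodular (x.submatrix id Fin.rev) := by
    intro i k hik j l hjl
    have := hx i k hik l.rev j.rev (by simpa using hjl)
    simp only [Matrix.neg_apply] at this
    simp only [Matrix.submatrix_apply, id]
    linarith
  have hT : IsBasicTransformation (mulRightLinearMap (Fin m) ℝ (exchangeMatrix n)) :=
    .exchangeColumns fun A => rfl
  filter_upwards [hy.eventually_mem] with t ht
  have h : expMatrix t x =
      mulRightLinearMap (Fin m) ℝ (exchangeMatrix n) (expMatrix t (x.submatrix id Fin.rev)) := by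
    ext i j
    simp [mul_exchangeMatrix_apply]
  rw [h]
  exact hT.mapsTo_strictlySignRegularOfOrder _ ht

/-- The standard strictly supermodular matrix `(i, j) ↦ i * j`. -/
def productMatrix (m n : ℕ) : Matrix (Fin m) (Fin n) ℝ := Matrix.of fun i j => (i : ℝ) * (j : ℝ)

theorem isStrictlySupermodular_productMatrix (m n : ℕ) :
    IsStrictlySupermodular (productMatrix m n) := by
  intro i k hik j l hjl
  have h₁ : (i : ℝ) < k := by exact_mod_cast hik
  have h₂ : (j : ℝ) < l := by exact_mod_cast hjl
  simp only [productMatrix, Matrix.of_apply]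
  nlinarith [mul_pos (sub_pos.2 h₁) (sub_pos.2 h₂)]

/-! ### Matrices that are supermodular up to sign -/

/-- The matrices `x` such that `x` or `-x` is supermodular: the entrywise logarithms of the positive
matrices in `SR₂`. -/
def supermodularUpToSign (m n : ℕ) : Set (Matrix (Fin m) (Fin n) ℝ) :=
  {x | IsSupermodular x ∨ IsSupermodular (-x)}

theorem isClosed_isSupermodular (m n : ℕ) :
    IsClosed {x : Matrix (Fin m) (Fin n) ℝ | IsSupermodular x} := by
  simp only [IsSupermodular, Set.ofPred_forall]
  refine isClosed_iInter fun i => isClosed_iInter fun k => isClosed_iInter fun _ =>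
    isClosed_iInter fun j => isClosed_iInter fun l => isClosed_iInter fun _ => ?_
  exact isClosed_le (by fun_prop) (by fun_prop)

theorem isClosed_supermodularUpToSign (m n : ℕ) : IsClosed (supermodularUpToSign m n) :=
  (isClosed_isSupermodular m n).union ((isClosed_isSupermodular m n).preimage continuous_neg)

theorem IsSupermodular.smul {m n : ℕ} {x : Matrix (Fin m) (Fin n) ℝ} (hx : IsSupermodular x)
    {t : ℝ} (ht : 0 ≤ t) : IsSupermodular (t • x) := by
  intro i k hik j l hjl
  have := mul_le_mul_of_nonneg_left (hx i k hik j l hjl) ht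
  simp only [Matrix.smul_apply, smul_eq_mul]
  linarith

theorem smul_mem_supermodularUpToSign {m n : ℕ} {x : Matrix (Fin m) (Fin n) ℝ}
    (hx : x ∈ supermodularUpToSign m n) {t : ℝ} (ht : 0 ≤ t) :
    t • x ∈ supermodularUpToSign m n :=
  hx.imp (fun h => h.smul ht) fun h => by rw [← smul_neg]; exact h.smul ht

theorem IsSupermodular.add_smul_productMatrix {m n : ℕ} {x : Matrix (Fin m) (Fin n) ℝ}
    (hx : IsSupermodular x) {t : ℝ} (ht : 0 < t) :
    IsStrictlySupermodular (x + t • productMatrix m n) := by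
  intro i k hik j l hjl
  have h₁ := hx i k hik j l hjl
  have h₂ := mul_lt_mul_of_pos_left (isStrictlySupermodular_productMatrix m n i k hik j l hjl) ht
  simp only [Matrix.add_apply, Matrix.smul_apply, smul_eq_mul]
  linarith

/-- The strictly supermodular matrices and their negatives are dense in `supermodularUpToSign`. -/
theorem mem_of_strict_mem {m n : ℕ} {Z : Set (Matrix (Fin m) (Fin n) ℝ)} (hZ : IsClosed Z)
    (h : ∀ x, IsStrictlySupermodular x ∨ IsStrictlySupermodular (-x) → x ∈ Z)
    {x : Matrix (Fin m) (Fin n) ℝ} (hx : x ∈ supermodularUpToSign m n) : x ∈ Z := by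
  have approx (s : ℝ) : Tendsto (fun t : ℝ => x + t • (s • productMatrix m n)) (𝓝[>] 0) (𝓝 x) := by
    have : Continuous fun t : ℝ => x + t • (s • productMatrix m n) := by fun_prop
    simpa using (this.tendsto 0).mono_left nhdsWithin_le_nhds
  rcases hx with hx | hx
  · refine hZ.mem_of_tendsto (approx 1) ?_
    filter_upwards [self_mem_nhdsWithin] with t ht
    rw [one_smul]
    exact h _ (Or.inl (hx.add_smul_productMatrix ht))
  · refine hZ.mem_of_tendsto (approx (-1)) ?_
    filter_upwards [self_mem_nhdsWithin] with t ht
    refine h _ (Or.inr ?_)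
    rw [neg_add, neg_one_smul, smul_neg, neg_neg]
    exact hx.add_smul_productMatrix ht

/-- If `exp x` or `-exp x`, taken entrywise, is in `SR₂`, then `x` is supermodular up to sign. -/
theorem mem_supermodularUpToSign_of_exp {m n : ℕ} {x A : Matrix (Fin m) (Fin n) ℝ} {ε : ℝ}
    (hε : ε = 1 ∨ ε = -1) (hA : A ∈ signRegularOfOrder m n 2)
    (hAx : ∀ i j, A i j = ε * Real.exp (x i j)) : x ∈ supermodularUpToSign m n := by
  have hprod : ∀ i j k l, A i j * A k l = Real.exp (x i j + x k l) := by
    intro i j k l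
    rw [hAx, hAx, Real.exp_add]
    rcases hε with rfl | rfl <;> ring
  refine (det_two_nonneg_or_nonpos_of_mem_signRegularOfOrder hA).imp ?_ ?_
  · intro h i k hik j l hjl
    simpa only [hprod, Real.exp_le_exp] using h i k hik j l hjl
  · intro h i k hik j l hjl
    have := h i k hik j l hjl
    simp only [hprod, Real.exp_le_exp] at this
    simp only [Matrix.neg_apply]
    linarith

/-! ### Linear maps between sign regular classes are monomial -/

theorem matrix_eq_sum_smul_single {m n : ℕ} (A : Matrix (Fin m) (Fin n) ℝ) :
    A = ∑ p : Fin m × Fin n, A p.1 p.2 • Matrix.single p.1 p.2 (1 : ℝ) := by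
  conv_lhs => rw [Matrix.matrix_eq_sum_single A]
  simp [Fintype.sum_prod_type, Matrix.smul_single]

theorem linearMap_apply_eq_sum {m n : ℕ}
    (L : Matrix (Fin m) (Fin n) ℝ →ₗ[ℝ] Matrix (Fin m) (Fin n) ℝ)
    (A : Matrix (Fin m) (Fin n) ℝ) (i : Fin m) (j : Fin n) :
    L A i j = ∑ p : Fin m × Fin n, A p.1 p.2 * L (Matrix.single p.1 p.2 1) i j := by
  conv_lhs => rw [matrix_eq_sum_smul_single A]
  simp only [map_sum, map_smul, Matrix.sum_apply, Matrix.smul_apply, smul_eq_mul]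

theorem single_one_apply_nonneg {N : ℕ} (a i : Fin N) :
    0 ≤ (Pi.single a 1 : Fin N → ℝ) i := by
  by_cases h : i = a <;> simp [h]

theorem exists_expMatrix_productMatrix_mem (m n : ℕ) :
    ∃ t, expMatrix t (productMatrix m n) ∈ strictlySignRegular m n :=
  (isStrictlySupermodular_productMatrix m n).eventually_mem.exists

/-- A linear map whose image contains all strictly sign regular matrices is surjective: diagonal
scalings of one such matrix already span all matrices. -/
theorem surjective_of_strictlySignRegular_subset {m n : ℕ}
    {L : Matrix (Fin m) (Fin n) ℝ →ₗ[ℝ] Matrix (Fin m) (Fin n) ℝ}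
    (hL : ∀ A ∈ strictlySignRegular m n, A ∈ LinearMap.range L) : Function.Surjective L := by
  obtain ⟨t, ht⟩ := exists_expMatrix_productMatrix_mem m n
  set V := expMatrix t (productMatrix m n) with hV
  have hmem : ∀ (F : Fin m → ℝ) (E : Fin n → ℝ), (∀ i, 0 < F i) → (∀ j, 0 < E j) →
      diagonalScaling F E V ∈ LinearMap.range L := fun F E hF hE =>
    hL _ ((isBasicTransformation_diagonalScaling hF hE).mapsTo_strictlySignRegularOfOrder _ ht)
  have pos {N : ℕ} (a i : Fin N) : 0 < 1 + (Pi.single a 1 : Fin N → ℝ) i :=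
    add_pos_of_pos_of_nonneg one_pos (single_one_apply_nonneg a i)
  have hsingle : ∀ a b, Matrix.single a b (1 : ℝ) ∈ LinearMap.range L := by
    intro a b
    have hne : V a b ≠ 0 := (Real.exp_pos _).ne'
    have : Matrix.single a b (1 : ℝ) = (V a b)⁻¹ •
        (diagonalScaling (1 + Pi.single a 1) (1 + Pi.single b 1) V
          - diagonalScaling (1 + Pi.single a 1) 1 V
          - diagonalScaling 1 (1 + Pi.single b 1) V
          + diagonalScaling 1 1 V) := by
      ext i j
      simp only [Matrix.smul_apply, Matrix.add_apply, Matrix.sub_apply, diagonalScaling_apply,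
        smul_eq_mul, Matrix.single_apply, Pi.single_apply, Pi.add_apply, Pi.one_apply]
      by_cases h₁ : i = a
      · by_cases h₂ : j = b
        · subst h₁ h₂
          simp only [and_self, if_true]
          field_simp
          ring
        · simp [h₁, h₂, Ne.symm h₂]
      · simp [h₁, Ne.symm h₁]
    rw [this]
    refine Submodule.smul_mem _ _ (Submodule.add_mem _ (Submodule.sub_mem _ (Submodule.sub_mem _
      ?_ ?_) ?_) ?_)
    all_goals exact hmem _ _ (by simp [pos]) (by simp [pos])
  intro A
  change A ∈ LinearMap.range L
  rw [matrix_eq_sum_smul_single A]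
  exact Submodule.sum_mem _ fun p _ => Submodule.smul_mem _ _ (hsingle _ _)

/-- An injective linear map from `SSR` to `SR₂` is, up to sign, entrywise nonnegative. The diagonal
scalings of one strictly sign regular matrix `V` form a connected family on which the sum of the
entries of the image does not vanish, so its sign is constant there; every matrix unit is a
multiple of a limit of such scalings of `V`. -/
theorem exists_sign_nonneg {m n : ℕ} (hm : 0 < m) (hn : 0 < n)
    {L : Matrix (Fin m) (Fin n) ℝ →ₗ[ℝ] Matrix (Fin m) (Fin n) ℝ} (hinj : Function.Injective L)
    (hL : ∀ A ∈ strictlySignRegular m n, L A ∈ signRegularOfOrder m n 2) :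
    ∃ ε : ℝ, (ε = 1 ∨ ε = -1) ∧ ∀ A, (∀ i j, 0 ≤ A i j) → ∀ i j, 0 ≤ ε * L A i j := by
  obtain ⟨t, ht⟩ := exists_expMatrix_productMatrix_mem m n
  set V := expMatrix t (productMatrix m n) with hV
  have hVpos : ∀ i j, 0 < V i j := fun i j => Real.exp_pos _
  let U : Set ((Fin m → ℝ) × (Fin n → ℝ)) := {p | (∀ i, 0 < p.1 i) ∧ ∀ j, 0 < p.2 j}
  have hU : Convex ℝ U := by
    intro p hp q hq a b ha hb hab
    have key : ∀ x y : ℝ, 0 < x → 0 < y → 0 < a * x + b * y := fun x y hx hy => by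
      rcases ha.eq_or_lt with rfl | ha
      · have : b = 1 := by linarith
        simpa [this] using hy
      · positivity
    exact ⟨fun i => key _ _ (hp.1 i) (hq.1 i), fun j => key _ _ (hp.2 j) (hq.2 j)⟩
  let W : (Fin m → ℝ) × (Fin n → ℝ) → Matrix (Fin m) (Fin n) ℝ :=
    fun p => diagonalScaling p.1 p.2 V
  have hLcont : Continuous L := L.continuous_of_finiteDimensional
  have hWcont : Continuous fun p => L (W p) := by
    refine hLcont.comp (continuous_matrix fun i j => ?_)
    simp only [W, diagonalScaling_apply]
    fun_prop
  let f : (Fin m → ℝ) × (Fin n → ℝ) → ℝ := fun p => ∑ i, ∑ j, L (W p) i j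
  have hfcont : Continuous f := continuous_finsetSum _ fun i _ =>
    continuous_finsetSum _ fun j _ => hWcont.matrix_elem i j
  have hmem : ∀ p ∈ U, L (W p) ∈ signRegularOfOrder m n 2 := fun p hp => hL _
    ((isBasicTransformation_diagonalScaling hp.1 hp.2).mapsTo_strictlySignRegularOfOrder _ ht)
  have hf0 : ∀ p ∈ U, f p ≠ 0 := by
    intro p hp h0
    have hzero : L (W p) = 0 := by
      rcases entries_nonneg_or_nonpos_of_mem_signRegularOfOrder (hmem p hp) with h | h
      · ext i j
        have := (Finset.sum_eq_zero_iff_of_nonneg fun i _ =>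
          Finset.sum_nonneg fun j _ => h i j).1 h0 i (Finset.mem_univ _)
        exact (Finset.sum_eq_zero_iff_of_nonneg fun j _ => h i j).1 this j (Finset.mem_univ _)
      · ext i j
        have := (Finset.sum_eq_zero_iff_of_nonpos fun i _ =>
          Finset.sum_nonpos fun j _ => h i j).1 h0 i (Finset.mem_univ _)
        exact (Finset.sum_eq_zero_iff_of_nonpos fun j _ => h i j).1 this j (Finset.mem_univ _)
    have hW0 : W p = 0 := hinj (by rw [hzero, map_zero])
    have : W p ⟨0, hm⟩ ⟨0, hn⟩ = 0 := by rw [hW0]; rfl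
    exact (mul_pos (mul_pos (hp.1 _) (hVpos _ _)) (hp.2 _)).ne' this
  obtain ⟨ε, hε, hpos⟩ : ∃ ε : ℝ, (ε = 1 ∨ ε = -1) ∧ ∀ p ∈ U, 0 < ε * f p := by
    by_cases h : ∀ p ∈ U, 0 < f p
    · exact ⟨1, Or.inl rfl, fun p hp => by simpa using h p hp⟩
    push Not at h
    obtain ⟨q, hq, hq0⟩ := h
    refine ⟨-1, Or.inr rfl, fun p hp => ?_⟩
    by_contra! hp0
    obtain ⟨x, hx, hx0⟩ := hU.isPreconnected.intermediate_value hq hp hfcont.continuousOn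
      (show (0 : ℝ) ∈ Set.Icc (f q) (f p) from ⟨hq0, by linarith⟩)
    exact hf0 x hx hx0
  have hnonneg : ∀ p ∈ U, ∀ i j, 0 ≤ ε * L (W p) i j := by
    intro p hp
    have hfp := hpos p hp
    rcases hε with rfl | rfl
    · rcases entries_nonneg_or_nonpos_of_mem_signRegularOfOrder (hmem p hp) with h | h
      · simpa using h
      · have : f p ≤ 0 := Finset.sum_nonpos fun i _ => Finset.sum_nonpos fun j _ => h i j
        linarith
    · rcases entries_nonneg_or_nonpos_of_mem_signRegularOfOrder (hmem p hp) with h | h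
      · have : 0 ≤ f p := Finset.sum_nonneg fun i _ => Finset.sum_nonneg fun j _ => h i j
        linarith
      · intro i j
        linarith [h i j]
  refine ⟨ε, hε, fun A hA i j => ?_⟩
  rw [linearMap_apply_eq_sum, Finset.mul_sum]
  refine Finset.sum_nonneg fun p _ => ?_
  obtain ⟨a, b⟩ := p
  have hlim : 0 ≤ ε * L (W (Pi.single a 1, Pi.single b 1)) i j := by
    let γ : ℝ → (Fin m → ℝ) × (Fin n → ℝ) := fun s =>
      (Pi.single a 1 + fun _ => s, Pi.single b 1 + fun _ => s)
    have hγ : Continuous γ := by fun_prop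
    have hcont : Continuous fun s => ε * L (W (γ s)) i j :=
      continuous_const.mul ((hWcont.comp hγ).matrix_elem i j)
    have h0 : γ 0 = (Pi.single a 1, Pi.single b 1) := by ext <;> simp [γ]
    rw [← h0]
    refine ge_of_tendsto ((hcont.tendsto 0).mono_left nhdsWithin_le_nhds :
      Tendsto _ (𝓝[>] (0 : ℝ)) _) ?_
    filter_upwards [self_mem_nhdsWithin] with s (hs : 0 < s)
    have pos {N : ℕ} (a i : Fin N) : 0 < (Pi.single a 1 : Fin N → ℝ) i + s :=
      add_pos_of_nonneg_of_pos (single_one_apply_nonneg a i) hs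
    exact hnonneg _ ⟨fun i => pos a i, fun j => pos b j⟩ i j
  have hW : W (Pi.single a 1, Pi.single b 1) = V a b • Matrix.single a b (1 : ℝ) := by
    ext i j
    by_cases h₁ : i = a
    · by_cases h₂ : j = b
      · simp [W, h₁, h₂]
      · simp [W, h₂, Ne.symm h₂]
    · simp [W, h₁, Ne.symm h₁]
  rw [hW, map_smul, Matrix.smul_apply, smul_eq_mul] at hlim
  have : 0 ≤ ε * L (Matrix.single a b 1) i j := by
    refine nonneg_of_mul_nonneg_right (b := ?_) (a := V a b) ?_ (hVpos a b)
    linarith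
  have := mul_nonneg (hA a b) this
  simp only
  linarith

/-- A linear bijection that is entrywise nonnegative together with its inverse is monomial: it
permutes the matrix units up to positive factors. -/
theorem exists_perm_of_nonneg {m n : ℕ}
    (e : Matrix (Fin m) (Fin n) ℝ ≃ₗ[ℝ] Matrix (Fin m) (Fin n) ℝ)
    (he : ∀ A, (∀ i j, 0 ≤ A i j) → ∀ i j, 0 ≤ e A i j)
    (he' : ∀ A, (∀ i j, 0 ≤ A i j) → ∀ i j, 0 ≤ e.symm A i j) :
    ∃ (σ : Equiv.Perm (Fin m × Fin n)) (c : Matrix (Fin m) (Fin n) ℝ), (∀ i j, 0 < c i j) ∧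
      ∀ A i j, e A i j = c i j * A (σ (i, j)).1 (σ (i, j)).2 := by
  let u : Fin m × Fin n → Matrix (Fin m) (Fin n) ℝ := fun p => Matrix.single p.1 p.2 1
  have hu : ∀ p i j, u p i j = if p = (i, j) then 1 else 0 := fun p i j => by
    simp [u, Matrix.single_apply, Prod.ext_iff]
  have hu0 : ∀ p i j, 0 ≤ u p i j := fun p i j => by rw [hu]; split_ifs <;> norm_num
  have hunit : ∀ p, ∃ q, ∃ c : ℝ, 0 < c ∧ e (u p) = c • u q := by
    rintro ⟨a, b⟩
    have hne : e (u (a, b)) ≠ 0 := fun h => by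
      have h0 : u (a, b) = 0 := e.injective (by rw [h, map_zero])
      have : u (a, b) a b = 0 := by rw [h0]; rfl
      simp [hu] at this
    obtain ⟨i, j, hij⟩ : ∃ i j, e (u (a, b)) i j ≠ 0 := by
      by_contra! h
      exact hne (Matrix.ext h)
    have hpos : 0 < e (u (a, b)) i j := (he _ (hu0 _) i j).lt_of_ne' hij
    set α := e (u (a, b)) i j with hα
    -- `α • u (i, j)` lies below `e (u (a, b))`, so its preimage lies below `u (a, b)`.
    have hle : ∀ k l, 0 ≤ (e (u (a, b)) - α • u (i, j)) k l := by
      intro k l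
      simp only [Matrix.sub_apply, Matrix.smul_apply, hu (i, j), smul_eq_mul]
      split_ifs with h
      · obtain ⟨rfl, rfl⟩ := Prod.mk.inj h
        simp [hα]
      · simpa using he _ (hu0 _) k l
    have hle' := he' _ hle
    have hsymm : e.symm (u (i, j)) = e.symm (u (i, j)) a b • u (a, b) := by
      ext k l
      simp only [Matrix.smul_apply, hu (a, b), smul_eq_mul]
      split_ifs with h
      · obtain ⟨rfl, rfl⟩ := Prod.mk.inj h
        simp
      · have h₁ := hle' k l
        have h₂ := he' _ (hu0 (i, j)) k l
        simp only [map_sub, map_smul, LinearEquiv.symm_apply_apply, Matrix.sub_apply,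
          Matrix.smul_apply, smul_eq_mul, hu (a, b), if_neg h] at h₁
        rw [mul_zero]
        nlinarith
    set d := e.symm (u (i, j)) a b
    have hd : u (i, j) = d • e (u (a, b)) := by
      rw [← map_smul, ← hsymm, LinearEquiv.apply_symm_apply]
    have hdα : d * α = 1 := by
      have := congrFun (congrFun hd i) j
      simp only [hu (i, j), if_true, Matrix.smul_apply, smul_eq_mul] at this
      rw [hα, ← this]
    exact ⟨(i, j), α, hpos, by rw [hd, smul_smul, mul_comm, hdα, one_smul]⟩
  choose τ c hc hτ using hunit
  have hinj : Function.Injective τ := by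
    rintro p ⟨i, j⟩ hpq
    have h : c (i, j) • u p = c p • u (i, j) := e.injective (by
      rw [map_smul, map_smul, hτ, hτ, hpq, smul_smul, smul_smul, mul_comm])
    by_contra hne
    have := congrFun (congrFun h i) j
    simp only [Matrix.smul_apply, hu, if_neg hne, if_true, smul_eq_mul] at this
    linarith [hc p]
  let σ : Equiv.Perm (Fin m × Fin n) :=
    (Equiv.ofBijective τ (Finite.injective_iff_bijective.1 hinj)).symm
  have hσ : ∀ p q, τ p = q ↔ p = σ q := fun p q => by
    rw [Equiv.eq_symm_apply]; rfl
  refine ⟨σ, Matrix.of fun i j => c (σ (i, j)), fun i j => hc _, fun A i j => ?_⟩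
  have h := linearMap_apply_eq_sum (e : _ →ₗ[ℝ] _) A i j
  rw [LinearEquiv.coe_coe] at h
  rw [h]
  have hterm : ∀ p : Fin m × Fin n, A p.1 p.2 * e (Matrix.single p.1 p.2 1) i j =
      if p = σ (i, j) then c p * A p.1 p.2 else 0 := by
    intro p
    change A p.1 p.2 * e (u p) i j = _
    rw [hτ, Matrix.smul_apply, hu, smul_eq_mul]
    simp only [hσ]
    split_ifs <;> ring
  simp [hterm]

/-- A linear map that maps onto itself a class between `SSR` and `SR₂` is monomial up to sign. -/
theorem exists_monomial_form {m n : ℕ} (hm : 0 < m) (hn : 0 < n)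
    {C : Set (Matrix (Fin m) (Fin n) ℝ)} (hC₁ : strictlySignRegular m n ⊆ C)
    (hC₂ : C ⊆ signRegularOfOrder m n 2)
    {L : Matrix (Fin m) (Fin n) ℝ →ₗ[ℝ] Matrix (Fin m) (Fin n) ℝ} (hL : L '' C = C) :
    ∃ ε : ℝ, (ε = 1 ∨ ε = -1) ∧
      ∃ (σ : Equiv.Perm (Fin m × Fin n)) (c : Matrix (Fin m) (Fin n) ℝ), (∀ i j, 0 < c i j) ∧
        ∀ A i j, L A i j = ε * (c i j * A (σ (i, j)).1 (σ (i, j)).2) := by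
  have hsurj : Function.Surjective L := surjective_of_strictlySignRegular_subset fun A hA => by
    obtain ⟨B, -, hB⟩ := hL.ge (hC₁ hA)
    exact ⟨B, hB⟩
  have hinj : Function.Injective L := LinearMap.injective_iff_surjective.2 hsurj
  let e := LinearEquiv.ofBijective L ⟨hinj, hsurj⟩
  have he : ∀ A, e A = L A := fun A => rfl
  obtain ⟨ε, hε, h⟩ := exists_sign_nonneg hm hn hinj fun A hA =>
    hC₂ (hL.le (Set.mem_image_of_mem L (hC₁ hA)))
  obtain ⟨ε', hε', h'⟩ := exists_sign_nonneg hm hn (L := e.symm.toLinearMap) e.symm.injective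
    fun A hA => by
      obtain ⟨B, hB, hBA⟩ := hL.ge (hC₁ hA)
      rw [← hBA, ← he]
      simpa using hC₂ hB
  simp only [LinearEquiv.coe_coe] at h'
  -- The two signs agree, since `L` and its inverse compose to the identity.
  have hεε' : ε * ε' = 1 := by
    have h₁ := h (ε' • e.symm (Matrix.of fun _ _ => 1)) (h' _ fun _ _ => zero_le_one)
      ⟨0, hm⟩ ⟨0, hn⟩
    rw [← he, map_smul, LinearEquiv.apply_symm_apply] at h₁
    simp only [Matrix.smul_apply, Matrix.of_apply, smul_eq_mul, mul_one] at h₁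
    rcases hε with rfl | rfl <;> rcases hε' with rfl | rfl <;> norm_num <;> norm_num at h₁
  have hεε : ε * ε = 1 := by rcases hε with rfl | rfl <;> norm_num
  have hεeq : ε' = ε := by linear_combination ε * hεε' - ε' * hεε
  have hε0 : ε ≠ 0 := fun h0 => by simp [h0] at hεε
  obtain ⟨σ, c, hc, hσ⟩ := exists_perm_of_nonneg (e.trans (LinearEquiv.smulOfNeZero ℝ _ ε hε0))
    (fun A hA i j => by simpa [he] using h A hA i j) (fun A hA i j => by
      have h₁ := h' A hA i j
      have h₂ : (e.trans (LinearEquiv.smulOfNeZero ℝ _ ε hε0)).symm A = ε • e.symm A := by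
        rw [LinearEquiv.symm_apply_eq]
        simp [smul_smul, hεε]
      rw [h₂]
      simpa [hεeq] using h₁)
  refine ⟨ε, hε, σ, c, hc, fun A i j => ?_⟩
  rw [← hσ]
  simp [he, ← mul_assoc, hεε]

/-! ### Translations preserving supermodularity up to sign -/

/-- A matrix `x` is modular if `x i j + x k l = x i l + x k j`, that is, if `x i j = r i + s j` for
suitable `r` and `s`. -/
def IsModular {m n : ℕ} (x : Matrix (Fin m) (Fin n) ℝ) : Prop :=
  ∀ i k j l, x i j + x k l = x i l + x k j

theorem IsModular.add_mem {m n : ℕ} {w y : Matrix (Fin m) (Fin n) ℝ} (hw : IsModular w)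
    (hy : y ∈ supermodularUpToSign m n) : w + y ∈ supermodularUpToSign m n := by
  refine hy.imp ?_ ?_ <;> intro h i k hik j l hjl
  all_goals
    have h₁ := h i k hik j l hjl
    have h₂ := hw i k j l
    simp only [Matrix.add_apply, Matrix.neg_apply] at h₁ ⊢
    linarith

/-- Let `E` be supermodular, with strict inequality at one quadruple of entries and equality at
another one. For large `s` the first quadruple forces `v + s • E` to be supermodular and `v - s • E`
to be the negative of a supermodular matrix. At the second quadruple `E` does not contribute, so
`v` satisfies both inequalities there. -/
theorem eq_of_forall_add_mem {m n : ℕ} {v E : Matrix (Fin m) (Fin n) ℝ}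
    (hv : ∀ y ∈ supermodularUpToSign m n, v + y ∈ supermodularUpToSign m n)
    (hE : IsSupermodular E) {i' k' : Fin m} {j' l' : Fin n} (hi' : i' < k') (hj' : j' < l')
    (hpos : E i' l' + E k' j' < E i' j' + E k' l') {i k : Fin m} {j l : Fin n} (hi : i < k)
    (hj : j < l) (hzero : E i j + E k l = E i l + E k j) :
    v i j + v k l = v i l + v k j := by
  set d := E i' j' + E k' l' - E i' l' - E k' j' with hd
  have hd0 : 0 < d := by linarith
  set b := v i' j' + v k' l' - v i' l' - v k' j' with hb
  set s := (|b| + 1) / d with hs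
  have hs0 : 0 ≤ s := by positivity
  have hsd : s * d = |b| + 1 := div_mul_cancel₀ _ hd0.ne'
  rw [hd] at hsd
  have hb₁ := le_abs_self b
  have hb₂ := neg_abs_le b
  have hz : s * (E i j + E k l) = s * (E i l + E k j) := by rw [hzero]
  have hneg : -(s • E) ∈ supermodularUpToSign m n := Or.inr (by rw [neg_neg]; exact hE.smul hs0)
  apply le_antisymm
  · rcases hv _ hneg with h | h
    · have := h i' k' hi' j' l' hj'
      simp only [Matrix.add_apply, Matrix.neg_apply, Matrix.smul_apply, smul_eq_mul] at this
      linarith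
    · have := h i k hi j l hj
      simp only [Matrix.add_apply, Matrix.neg_apply, Matrix.smul_apply, smul_eq_mul] at this
      linarith
  · rcases hv _ (Or.inl (hE.smul hs0)) with h | h
    · have := h i k hi j l hj
      simp only [Matrix.add_apply, Matrix.smul_apply, smul_eq_mul] at this
      linarith
    · have := h i' k' hi' j' l' hj'
      simp only [Matrix.add_apply, Matrix.neg_apply, Matrix.smul_apply, smul_eq_mul] at this
      linarith

/-- Only translations by modular matrices preserve supermodularity up to sign. This is where
`2 × 2` matrices are an exception: for them every matrix is supermodular up to sign. -/
theorem isModular_of_forall_add_mem {m n : ℕ} (hm : 2 ≤ m) (hn : 2 ≤ n) (hmn : 3 ≤ m ∨ 3 ≤ n)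
    {v : Matrix (Fin m) (Fin n) ℝ}
    (hv : ∀ y ∈ supermodularUpToSign m n, v + y ∈ supermodularUpToSign m n) : IsModular v := by
  let i₀ : Fin m := ⟨0, by omega⟩
  let i₁ : Fin m := ⟨m - 1, by omega⟩
  let j₀ : Fin n := ⟨0, by omega⟩
  let j₁ : Fin n := ⟨n - 1, by omega⟩
  have hi₀₁ : i₀ < i₁ := Fin.mk_lt_mk.2 (by omega)
  have hj₀₁ : j₀ < j₁ := Fin.mk_lt_mk.2 (by omega)
  have hi₀ : ∀ {i k : Fin m}, i < k → k ≠ i₀ := fun {i k} h h' => by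
    subst h'; exact absurd (Fin.lt_def.1 h) (by simp [i₀])
  have hj₀ : ∀ {i k : Fin n}, i < k → k ≠ j₀ := fun {i k} h h' => by
    subst h'; exact absurd (Fin.lt_def.1 h) (by simp [j₀])
  have hi₁ : ∀ {i k : Fin m}, i < k → i ≠ i₁ := fun {i k} h h' => by
    subst h'; have := Fin.lt_def.1 h; simp only [i₁] at this; omega
  have hj₁ : ∀ {i k : Fin n}, i < k → i ≠ j₁ := fun {i k} h h' => by
    subst h'; have := Fin.lt_def.1 h; simp only [j₁] at this; omega
  have hmid : (∃ a, i₀ < a ∧ a < i₁) ∨ ∃ a, j₀ < a ∧ a < j₁ := hmn.imp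
    (fun h => ⟨⟨1, by omega⟩, Fin.mk_lt_mk.2 (by omega), Fin.mk_lt_mk.2 (by omega)⟩)
    fun h => ⟨⟨1, by omega⟩, Fin.mk_lt_mk.2 (by omega), Fin.mk_lt_mk.2 (by omega)⟩
  clear_value i₀ i₁ j₀ j₁
  -- Minors avoiding the top left corner, respectively the bottom right corner.
  have h₀ : ∀ i k, i < k → ∀ j l, j < l → ¬(i₀ = i ∧ j₀ = j) →
      v i j + v k l = v i l + v k j := by
    intro i k hik j l hjl hne
    refine eq_of_forall_add_mem hv (E := Matrix.single i₀ j₀ 1) ?_ hi₀₁ hj₀₁ ?_ hik hjl ?_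
    · intro i k hik j l hjl
      simp only [Matrix.single_apply, (hi₀ hik).symm, (hj₀ hjl).symm, false_and, and_false, if_false]
      split_ifs <;> norm_num
    · simp [hi₀₁.ne, hj₀₁.ne]
    · simp only [Matrix.single_apply, (hi₀ hik).symm, (hj₀ hjl).symm, hne, false_and, and_false,
        if_false]
  have h₁ : ∀ i k, i < k → ∀ j l, j < l → ¬(i₁ = k ∧ j₁ = l) →
      v i j + v k l = v i l + v k j := by
    intro i k hik j l hjl hne
    refine eq_of_forall_add_mem hv (E := Matrix.single i₁ j₁ 1) ?_ hi₀₁ hj₀₁ ?_ hik hjl ?_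
    · intro i k hik j l hjl
      simp only [Matrix.single_apply, (hi₁ hik).symm, (hj₁ hjl).symm, false_and, and_false, if_false]
      split_ifs <;> norm_num
    · simp [hi₀₁.ne', hj₀₁.ne']
    · simp only [Matrix.single_apply, (hi₁ hik).symm, (hj₁ hjl).symm, hne, false_and, and_false,
        if_false]
  -- The minor on all four corners is split along a third row or column.
  have hcorner : v i₀ j₀ + v i₁ j₁ = v i₀ j₁ + v i₁ j₀ := by
    rcases hmid with ⟨a, h, h'⟩ | ⟨a, h, h'⟩
    · have := h₁ _ _ h _ _ hj₀₁ fun e => h'.ne' e.1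
      have := h₀ _ _ h' _ _ hj₀₁ fun e => h.ne e.1
      linarith
    · have := h₁ _ _ hi₀₁ _ _ h fun e => h'.ne' e.2
      have := h₀ _ _ hi₀₁ _ _ h' fun e => h.ne e.2
      linarith
  have key : ∀ i k, i < k → ∀ j l, j < l → v i j + v k l = v i l + v k j := by
    intro i k hik j l hjl
    by_cases h : i₀ = i ∧ j₀ = j
    · by_cases h' : i₁ = k ∧ j₁ = l
      · rw [← h.1, ← h.2, ← h'.1, ← h'.2]
        exact hcorner
      · exact h₁ i k hik j l hjl h'
    · exact h₀ i k hik j l hjl h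
  intro i k j l
  rcases lt_trichotomy i k with hik | rfl | hik <;> rcases lt_trichotomy j l with hjl | rfl | hjl
  · exact key _ _ hik _ _ hjl
  · ring
  · linarith [key _ _ hik _ _ hjl]
  · ring
  · ring
  · ring
  · linarith [key _ _ hik _ _ hjl]
  · ring
  · linarith [key _ _ hik _ _ hjl]

/-! ### Permutations of the entries preserving supermodularity up to sign -/

/-- The matrix `x` with its entries permuted by `σ`. -/
def permuteEntries {m n : ℕ} (σ : Equiv.Perm (Fin m × Fin n)) (x : Matrix (Fin m) (Fin n) ℝ) :
    Matrix (Fin m) (Fin n) ℝ :=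
  Matrix.of fun i j => x (σ (i, j)).1 (σ (i, j)).2

@[simp] theorem permuteEntries_apply {m n : ℕ} (σ : Equiv.Perm (Fin m × Fin n))
    (x : Matrix (Fin m) (Fin n) ℝ) (i : Fin m) (j : Fin n) :
    permuteEntries σ x i j = x (σ (i, j)).1 (σ (i, j)).2 := rfl

theorem continuous_permuteEntries {m n : ℕ} (σ : Equiv.Perm (Fin m × Fin n)) :
    Continuous (permuteEntries σ) :=
  continuous_matrix fun i j => by simp only [permuteEntries_apply]; fun_prop

theorem permuteEntries_inv_mem {m n : ℕ} {σ : Equiv.Perm (Fin m × Fin n)}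
    (hσ : ∀ x ∈ supermodularUpToSign m n, permuteEntries σ x ∈ supermodularUpToSign m n) :
    ∀ x ∈ supermodularUpToSign m n, permuteEntries σ⁻¹ x ∈ supermodularUpToSign m n := by
  have hpow : ∀ N : ℕ, ∀ x ∈ supermodularUpToSign m n,
      permuteEntries (σ ^ N) x ∈ supermodularUpToSign m n := by
    intro N
    induction N with
    | zero => exact fun x hx => hx
    | succ N ih => exact fun x hx => hσ _ (ih x hx)
  have h : σ⁻¹ = σ ^ (orderOf σ - 1) := by
    rw [inv_eq_iff_mul_eq_one, ← pow_succ', Nat.sub_add_cancel (orderOf_pos σ), pow_orderOf_eq_one]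
  rw [h]
  exact hpow _

/-- A permutation of the entries that preserves supermodularity up to sign preserves modularity:
the modular matrices are the translations preserving supermodularity up to sign. -/
theorem isModular_permuteEntries {m n : ℕ} (hm : 2 ≤ m) (hn : 2 ≤ n) (hmn : 3 ≤ m ∨ 3 ≤ n)
    {σ : Equiv.Perm (Fin m × Fin n)}
    (hσ : ∀ x ∈ supermodularUpToSign m n, permuteEntries σ x ∈ supermodularUpToSign m n)
    {w : Matrix (Fin m) (Fin n) ℝ} (hw : IsModular w) : IsModular (permuteEntries σ w) := by
  refine isModular_of_forall_add_mem hm hn hmn fun y hy => ?_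
  have h : permuteEntries σ w + y = permuteEntries σ (w + permuteEntries σ⁻¹ y) := by
    ext i j
    simp
  rw [h]
  exact hσ _ (hw.add_mem (permuteEntries_inv_mem hσ y hy))

/-- A function of two variables all of whose compositions with real functions are modular depends
on one of the variables only. -/
theorem depends_on_one_variable {α β γ : Type*} {F : α → β → γ}
    (hF : ∀ h : γ → ℝ, ∀ i k j l, h (F i j) + h (F k l) = h (F i l) + h (F k j)) :
    (∀ i j l, F i j = F i l) ∨ ∀ i k j, F i j = F k j := by
  classical
  by_contra! hcon
  obtain ⟨⟨c, d, d', hd⟩, a, a', b, ha⟩ := hcon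
  let ind (p : γ) : γ → ℝ := fun q => if q = p then 1 else 0
  have h₁ : F a' d ≠ F a d := by
    intro h
    have := hF (ind (F a b)) a a' b d
    simp [ind, h, Ne.symm ha, add_comm] at this
  have h₂ : F a d' ≠ F a d := by
    intro h
    have := hF (ind (F c d)) a c d' d
    simp [ind, h, Ne.symm hd] at this
  have := hF (ind (F a d)) a a' d d'
  simp only [ind, if_true, if_neg h₁, if_neg h₂] at this
  split_ifs at this <;> norm_num at this

theorem strictMono_or_strictAnti_of_mul_mem {m n : ℕ} (hm : 2 ≤ m) (hn : 2 ≤ n) {p : Fin m → ℝ}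
    {q : Fin n → ℝ} (hp : Function.Injective p) (hq : Function.Injective q)
    (h : (Matrix.of fun i j => p i * q j) ∈ supermodularUpToSign m n) :
    (StrictMono p ∨ StrictAnti p) ∧ (StrictMono q ∨ StrictAnti q) := by
  have hsign : (∀ i k, i < k → ∀ j l, j < l → 0 < (p k - p i) * (q l - q j)) ∨
      ∀ i k, i < k → ∀ j l, j < l → (p k - p i) * (q l - q j) < 0 := by
    have hne : ∀ i k, i < k → ∀ j l, j < l → (p k - p i) * (q l - q j) ≠ 0 :=
      fun i k hik j l hjl => mul_ne_zero (sub_ne_zero.2 (hp.ne hik.ne'))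
        (sub_ne_zero.2 (hq.ne hjl.ne'))
    refine h.imp ?_ ?_
    · intro h i k hik j l hjl
      have := h i k hik j l hjl
      simp only [Matrix.of_apply] at this
      exact lt_of_le_of_ne (by linarith) (hne i k hik j l hjl).symm
    · intro h i k hik j l hjl
      have := h i k hik j l hjl
      simp only [Matrix.of_apply, Matrix.neg_apply] at this
      exact lt_of_le_of_ne (by linarith) (hne i k hik j l hjl)
  have hi : (⟨0, by omega⟩ : Fin m) < ⟨1, by omega⟩ := Fin.mk_lt_mk.2 one_pos
  have hj : (⟨0, by omega⟩ : Fin n) < ⟨1, by omega⟩ := Fin.mk_lt_mk.2 one_pos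
  constructor
  · rcases (hq.ne hj.ne).lt_or_gt with hlt | hlt <;> rcases hsign with h | h
    · exact Or.inl fun i k hik => sub_pos.1
        (pos_of_mul_pos_left (h i k hik _ _ hj) (sub_pos.2 hlt).le)
    · exact Or.inr fun i k hik => sub_neg.1
        (neg_of_mul_neg_left (h i k hik _ _ hj) (sub_pos.2 hlt).le)
    · exact Or.inr fun i k hik => by nlinarith [h i k hik _ _ hj]
    · exact Or.inl fun i k hik => by nlinarith [h i k hik _ _ hj]
  · rcases (hp.ne hi.ne).lt_or_gt with hlt | hlt <;> rcases hsign with h | h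
    · exact Or.inl fun j l hjl => by nlinarith [h _ _ hi j l hjl]
    · exact Or.inr fun j l hjl => by nlinarith [h _ _ hi j l hjl]
    · exact Or.inr fun j l hjl => by nlinarith [h _ _ hi j l hjl]
    · exact Or.inl fun j l hjl => by nlinarith [h _ _ hi j l hjl]

theorem eq_id_or_eq_rev {N : ℕ} {π : Fin N → Fin N}
    (h : StrictMono (fun i => ((π i : ℕ) : ℝ)) ∨ StrictAnti fun i => ((π i : ℕ) : ℝ)) :
    π = id ∨ π = Fin.rev := by
  have eq_id {τ : Fin N → Fin N} (hτ : StrictMono τ) : τ = id := by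
    have := perm_eq_one_of_strictMono
      (π := Equiv.ofBijective τ (Finite.injective_iff_bijective.1 hτ.injective)) hτ
    funext i
    exact congrArg (fun e : Equiv.Perm (Fin N) => e i) this
  refine h.imp (fun h => eq_id fun i j hij => ?_) fun h => ?_
  · exact Nat.cast_lt.1 (h hij)
  · have : (fun i => (π i).rev) = id := eq_id fun i j hij => by
      have : π j < π i := Nat.cast_lt.1 (h hij)
      simpa using this
    funext i
    rw [← Fin.rev_rev (π i)]
    exact congrArg Fin.rev (congrFun this i)

/-! ### Permutations of the entries as compositions of basic transformations -/

theorem isCompositionOfBasic_diagonalScaling_one {m n : ℕ} :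
    IsCompositionOfBasic (diagonalScaling (1 : Fin m → ℝ) (1 : Fin n → ℝ)) :=
  .basic (isBasicTransformation_diagonalScaling (fun _ => one_pos) fun _ => one_pos)

theorem exists_isCompositionOfBasic_submatrix {m n : ℕ} {π : Fin m → Fin m} {ω : Fin n → Fin n}
    (hπ : π = id ∨ π = Fin.rev) (hω : ω = id ∨ ω = Fin.rev) :
    ∃ B : Matrix (Fin m) (Fin n) ℝ →ₗ[ℝ] Matrix (Fin m) (Fin n) ℝ, IsCompositionOfBasic B ∧
      ∀ A i j, B A i j = A (π i) (ω j) := by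
  obtain ⟨B₁, hB₁, h₁⟩ : ∃ B : Matrix (Fin m) (Fin n) ℝ →ₗ[ℝ] Matrix (Fin m) (Fin n) ℝ,
      IsCompositionOfBasic B ∧ ∀ A i j, B A i j = A (π i) j := by
    rcases hπ with rfl | rfl
    · exact ⟨_, isCompositionOfBasic_diagonalScaling_one, fun A i j => by simp⟩
    · exact ⟨mulLeftLinearMap (Fin n) ℝ (exchangeMatrix m), .basic (.exchangeRows fun A => rfl),
        fun A i j => exchangeMatrix_mul_apply A i j⟩
  obtain ⟨B₂, hB₂, h₂⟩ : ∃ B : Matrix (Fin m) (Fin n) ℝ →ₗ[ℝ] Matrix (Fin m) (Fin n) ℝ,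
      IsCompositionOfBasic B ∧ ∀ A i j, B A i j = A i (ω j) := by
    rcases hω with rfl | rfl
    · exact ⟨_, isCompositionOfBasic_diagonalScaling_one, fun A i j => by simp⟩
    · exact ⟨mulRightLinearMap (Fin m) ℝ (exchangeMatrix n), .basic (.exchangeColumns fun A => rfl),
        fun A i j => mul_exchangeMatrix_apply A i j⟩
  exact ⟨B₁ ∘ₗ B₂, .comp hB₁ hB₂, fun A i j => by rw [LinearMap.comp_apply, h₁, h₂]⟩

/-- A permutation of the entries that preserves supermodularity up to sign is a composition of
reversals of the rows and the columns and, for square matrices, the transposition. -/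
theorem exists_isCompositionOfBasic_permuteEntries {m n : ℕ} (hm : 2 ≤ m) (hn : 2 ≤ n)
    (hmn : 3 ≤ m ∨ 3 ≤ n) {σ : Equiv.Perm (Fin m × Fin n)}
    (hσ : ∀ x ∈ supermodularUpToSign m n, permuteEntries σ x ∈ supermodularUpToSign m n) :
    ∃ B : Matrix (Fin m) (Fin n) ℝ →ₗ[ℝ] Matrix (Fin m) (Fin n) ℝ, IsCompositionOfBasic B ∧
      ∀ A, B A = permuteEntries σ A := by
  have hmod : ∀ w : Matrix (Fin m) (Fin n) ℝ, IsModular w → IsModular (permuteEntries σ w) :=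
    fun w hw => isModular_permuteEntries hm hn hmn hσ hw
  have hrow := depends_on_one_variable (F := fun i j => (σ (i, j)).1)
    fun h => hmod (Matrix.of fun i _ => h i) fun i k j l => rfl
  have hcol := depends_on_one_variable (F := fun i j => (σ (i, j)).2)
    fun h => hmod (Matrix.of fun _ j => h j) fun i k j l => add_comm _ _
  let i₀ : Fin m := ⟨0, by omega⟩
  let i₁ : Fin m := ⟨1, by omega⟩
  let j₀ : Fin n := ⟨0, by omega⟩
  let j₁ : Fin n := ⟨1, by omega⟩
  have hi₀₁ : i₀ ≠ i₁ := by simp [i₀, i₁]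
  have hj₀₁ : j₀ ≠ j₁ := by simp [j₀, j₁]
  have hprod := hσ _ (Or.inl fun i k hik j l hjl =>
    (isStrictlySupermodular_productMatrix m n i k hik j l hjl).le)
  rcases hrow with hrow | hrow <;> rcases hcol with hcol | hcol
  · have := σ.injective (Prod.ext (hrow i₀ j₀ j₁) (hcol i₀ j₀ j₁))
    exact absurd (Prod.mk.inj this).2 hj₀₁
  · let π : Fin m → Fin m := fun i => (σ (i, j₀)).1
    let ω : Fin n → Fin n := fun j => (σ (i₀, j)).2
    have hσπω : ∀ i j, σ (i, j) = (π i, ω j) := fun i j =>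
      Prod.ext (hrow i j j₀) (hcol i i₀ j)
    have hπ : Function.Injective fun i => ((π i : ℕ) : ℝ) := fun i k hik => by
      have hik' : π i = π k := Fin.ext (Nat.cast_injective hik)
      have := σ.injective (show σ (i, j₀) = σ (k, j₀) by rw [hσπω, hσπω, hik'])
      exact (Prod.mk.inj this).1
    have hω : Function.Injective fun j => ((ω j : ℕ) : ℝ) := fun j l hjl => by
      have hjl' : ω j = ω l := Fin.ext (Nat.cast_injective hjl)
      have := σ.injective (show σ (i₀, j) = σ (i₀, l) by rw [hσπω, hσπω, hjl'])
      exact (Prod.mk.inj this).2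
    have hmono := strictMono_or_strictAnti_of_mul_mem hm hn hπ hω (by
      convert hprod using 1
      ext i j
      simp [productMatrix, hσπω])
    obtain ⟨B, hB, hBA⟩ := exists_isCompositionOfBasic_submatrix (eq_id_or_eq_rev hmono.1)
      (eq_id_or_eq_rev hmono.2)
    exact ⟨B, hB, fun A => by ext i j; simp [hBA, hσπω]⟩
  · -- Rows go to columns, so both index types have the same size.
    let π : Fin n → Fin m := fun j => (σ (i₀, j)).1
    let ω : Fin m → Fin n := fun i => (σ (i, j₀)).2
    have hσπω : ∀ i j, σ (i, j) = (π j, ω i) := fun i j =>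
      Prod.ext (hrow i i₀ j) (hcol i j j₀)
    have hπ : Function.Injective fun j => ((π j : ℕ) : ℝ) := fun j l hjl => by
      have hjl' : π j = π l := Fin.ext (Nat.cast_injective hjl)
      have := σ.injective (show σ (i₀, j) = σ (i₀, l) by rw [hσπω, hσπω, hjl'])
      exact (Prod.mk.inj this).2
    have hω : Function.Injective fun i => ((ω i : ℕ) : ℝ) := fun i k hik => by
      have hik' : ω i = ω k := Fin.ext (Nat.cast_injective hik)
      have := σ.injective (show σ (i, j₀) = σ (k, j₀) by rw [hσπω, hσπω, hik'])
      exact (Prod.mk.inj this).1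
    have hmn : m = n := by
      have h₁ := Fintype.card_le_of_injective π fun j l h => hπ (by simp [h])
      have h₂ := Fintype.card_le_of_injective ω fun j l h => hω (by simp [h])
      simp only [Fintype.card_fin] at h₁ h₂
      omega
    have hmono := strictMono_or_strictAnti_of_mul_mem hm hn hω hπ (by
      convert hprod using 1
      ext i j
      simp [productMatrix, hσπω, mul_comm])
    clear_value π ω
    subst hmn
    obtain ⟨B, hB, hBA⟩ := exists_isCompositionOfBasic_submatrix (eq_id_or_eq_rev hmono.2)
      (eq_id_or_eq_rev hmono.1)
    have hT : IsCompositionOfBasic (m := m) (n := m)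
        (Matrix.transposeLinearEquiv (Fin m) (Fin m) ℝ ℝ).toLinearMap :=
      .basic (.transposition rfl fun A => rfl)
    exact ⟨_, .comp hT hB, fun A => by ext i j; simp [hBA, hσπω]⟩
  · have := σ.injective (Prod.ext (hrow i₀ i₁ j₀) (hcol i₀ i₁ j₀))
    exact absurd (Prod.mk.inj this).1 hi₀₁

/-! ### Linear maps onto a class between `SSR` and `SR₂` -/

/-- If `L` is monomial with entry permutation `σ` and maps `SSR` into `SR₂`, then `σ` preserves
supermodularity up to sign. Indeed `L` maps `exp (t • x)` to the exponential of
`log c + t • permuteEntries σ x`, and the first term becomes negligible for large `t`. -/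
theorem permuteEntries_mem {m n : ℕ}
    {L : Matrix (Fin m) (Fin n) ℝ →ₗ[ℝ] Matrix (Fin m) (Fin n) ℝ}
    (hL : ∀ A ∈ strictlySignRegular m n, L A ∈ signRegularOfOrder m n 2) {ε : ℝ}
    (hε : ε = 1 ∨ ε = -1) {σ : Equiv.Perm (Fin m × Fin n)} {c : Matrix (Fin m) (Fin n) ℝ}
    (hc : ∀ i j, 0 < c i j) (hLσ : ∀ A i j, L A i j = ε * (c i j * A (σ (i, j)).1 (σ (i, j)).2))
    (x : Matrix (Fin m) (Fin n) ℝ) (hx : x ∈ supermodularUpToSign m n) :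
    permuteEntries σ x ∈ supermodularUpToSign m n := by
  refine mem_of_strict_mem (Z := permuteEntries σ ⁻¹' supermodularUpToSign m n)
    ((isClosed_supermodularUpToSign m n).preimage (continuous_permuteEntries σ)) ?_ hx
  intro x hx
  have hev : ∀ᶠ t in atTop, expMatrix t x ∈ strictlySignRegular m n :=
    hx.elim (fun h => h.eventually_mem) fun h => h.eventually_mem_of_neg
  have hlim : Tendsto (fun t : ℝ => t⁻¹ • c.map Real.log + permuteEntries σ x) atTop
      (𝓝 (permuteEntries σ x)) := by
    simpa using ((tendsto_inv_atTop_zero (𝕜 := ℝ)).smul_const (c.map Real.log)).add_const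
      (permuteEntries σ x)
  refine (isClosed_supermodularUpToSign m n).mem_of_tendsto hlim ?_
  filter_upwards [hev, eventually_gt_atTop 0] with t ht ht0
  have h : c.map Real.log + t • permuteEntries σ x ∈ supermodularUpToSign m n :=
    mem_supermodularUpToSign_of_exp hε (hL _ ht) fun i j => by
      rw [hLσ]
      simp [Real.exp_add, Real.exp_log (hc i j)]
  have := smul_mem_supermodularUpToSign h (inv_pos.2 ht0).le
  rwa [smul_add, smul_smul, inv_mul_cancel₀ ht0.ne', one_smul] at this

/-- If the Hadamard product with `c`, up to sign, preserves a class between `SSR` and `SR₂`, then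
`log c` is modular: the iterates of the map show that translation by `log c` preserves
supermodularity up to sign. -/
theorem isModular_log {m n : ℕ} (hm : 2 ≤ m) (hn : 2 ≤ n) (hmn : 3 ≤ m ∨ 3 ≤ n)
    {C : Set (Matrix (Fin m) (Fin n) ℝ)} (hC₁ : strictlySignRegular m n ⊆ C)
    (hC₂ : C ⊆ signRegularOfOrder m n 2)
    {L : Matrix (Fin m) (Fin n) ℝ →ₗ[ℝ] Matrix (Fin m) (Fin n) ℝ} (hL : Set.MapsTo L C C)
    {ε : ℝ} (hε : ε = 1 ∨ ε = -1) {c : Matrix (Fin m) (Fin n) ℝ} (hc : ∀ i j, 0 < c i j)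
    (hLc : ∀ A i j, L A i j = ε * (c i j * A i j)) : IsModular (c.map Real.log) := by
  refine isModular_of_forall_add_mem hm hn hmn fun y hy => ?_
  refine mem_of_strict_mem (Z := (c.map Real.log + ·) ⁻¹' supermodularUpToSign m n)
    ((isClosed_supermodularUpToSign m n).preimage (by fun_prop)) ?_ hy
  intro y hy
  have hev : ∀ᶠ t in atTop, expMatrix t y ∈ strictlySignRegular m n :=
    hy.elim (fun h => h.eventually_mem) fun h => h.eventually_mem_of_neg
  obtain ⟨N, hN, hN0⟩ := ((tendsto_natCast_atTop_atTop.eventually hev).and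
    (eventually_gt_atTop 0)).exists
  have hiter : ∀ (N : ℕ) (A : Matrix (Fin m) (Fin n) ℝ) (i : Fin m) (j : Fin n),
      L^[N] A i j = ε ^ N * (c i j ^ N * A i j) := by
    intro N
    induction N with
    | zero => intro A i j; simp
    | succ N ih =>
      intro A i j
      rw [Function.iterate_succ_apply, ih, hLc]
      ring
  have hεN : ε ^ N = 1 ∨ ε ^ N = -1 := by
    rcases hε with rfl | rfl
    · exact Or.inl (one_pow N)
    · exact neg_one_pow_eq_or ℝ N
  have hN0' : (0 : ℝ) < N := Nat.cast_pos.2 hN0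
  have h : (N : ℝ) • (c.map Real.log + y) ∈ supermodularUpToSign m n :=
    mem_supermodularUpToSign_of_exp hεN (hC₂ (hL.iterate N (hC₁ hN))) fun i j => by
      rw [hiter, expMatrix_apply, Matrix.smul_apply, Matrix.add_apply, Matrix.map_apply,
        smul_eq_mul, mul_add, Real.exp_add, Real.exp_nat_mul, Real.exp_nat_mul,
        Real.exp_log (hc i j)]
  have := smul_mem_supermodularUpToSign h (inv_pos.2 hN0').le
  rwa [smul_smul, inv_mul_cancel₀ hN0'.ne', one_smul] at this

theorem isCompositionOfBasic_of_isModular_log {m n : ℕ} (hm : 0 < m) (hn : 0 < n)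
    {L : Matrix (Fin m) (Fin n) ℝ →ₗ[ℝ] Matrix (Fin m) (Fin n) ℝ} {ε : ℝ}
    (hε : ε = 1 ∨ ε = -1) {c : Matrix (Fin m) (Fin n) ℝ} (hc : ∀ i j, 0 < c i j)
    (hmod : IsModular (c.map Real.log)) (hLc : ∀ A i j, L A i j = ε * (c i j * A i j)) :
    IsCompositionOfBasic L := by
  let i₀ : Fin m := ⟨0, hm⟩
  let j₀ : Fin n := ⟨0, hn⟩
  let F : Fin m → ℝ := fun i => c i j₀
  let E : Fin n → ℝ := fun j => c i₀ j / c i₀ j₀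
  have hcFE : ∀ i j, c i j = F i * E j := by
    intro i j
    have h := congrArg Real.exp (hmod i i₀ j j₀)
    simp only [Matrix.map_apply, Real.exp_add, Real.exp_log (hc _ _)] at h
    simp only [F, E]
    rw [← mul_div_assoc, eq_div_iff (hc _ _).ne', h]
  have hD : IsCompositionOfBasic (diagonalScaling F E) :=
    .basic (isBasicTransformation_diagonalScaling (fun i => hc _ _)
      fun j => div_pos (hc _ _) (hc _ _))
  rcases hε with rfl | rfl
  · have : L = diagonalScaling F E := by
      ext1 A
      ext i j
      rw [hLc, hcFE, diagonalScaling_apply]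
      ring
    exact this ▸ hD
  · have hneg : IsCompositionOfBasic (m := m) (n := n) (-LinearMap.id) :=
      .basic (.negation fun A => rfl)
    have : L = (-LinearMap.id) ∘ₗ diagonalScaling F E := by
      ext1 A
      ext i j
      rw [hLc, hcFE, LinearMap.comp_apply, LinearMap.neg_apply, LinearMap.id_apply,
        Matrix.neg_apply, diagonalScaling_apply]
      ring
    exact this ▸ .comp hneg hD

/-- A linear map that maps onto itself a class between `SSR` and `SR₂` that is stable under basic
transformations is a composition of basic transformations. -/
theorem isCompositionOfBasic_of_image_eq {m n : ℕ} (hm : 2 ≤ m) (hn : 2 ≤ n)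
    (hmn : 3 ≤ m ∨ 3 ≤ n) {C : Set (Matrix (Fin m) (Fin n) ℝ)}
    (hC₁ : strictlySignRegular m n ⊆ C) (hC₂ : C ⊆ signRegularOfOrder m n 2)
    (hC₃ : ∀ B, IsBasicTransformation B → Set.MapsTo B C C)
    {L : Matrix (Fin m) (Fin n) ℝ →ₗ[ℝ] Matrix (Fin m) (Fin n) ℝ} (hL : L '' C = C) :
    IsCompositionOfBasic L := by
  obtain ⟨ε, hε, σ, c, hc, hLσ⟩ := exists_monomial_form (by omega) (by omega) hC₁ hC₂ hL
  have hLC : Set.MapsTo L C C := Set.mapsTo_iff_image_subset.2 hL.le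
  obtain ⟨B, hB, hBσ⟩ := exists_isCompositionOfBasic_permuteEntries hm hn hmn
    (permuteEntries_mem (fun A hA => hC₂ (hLC (hC₁ hA))) hε hc hLσ)
  obtain ⟨B', hB', h₁, h₂⟩ := hB.exists_inverse
  have hB'C : Set.MapsTo B' C C := Set.mapsTo_iff_image_subset.2 (hB'.image_eq hC₃).le
  have hM : ∀ A i j, (L ∘ₗ B') A i j = ε * (c i j * A i j) := by
    intro A i j
    rw [LinearMap.comp_apply, hLσ, ← permuteEntries_apply σ (B' A), ← hBσ, h₁]
  have hcomp : IsCompositionOfBasic (L ∘ₗ B') :=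
    isCompositionOfBasic_of_isModular_log (by omega) (by omega) hε hc
      (isModular_log (L := L ∘ₗ B') hm hn hmn hC₁ hC₂ (hLC.comp hB'C) hε hc hM) hM
  have : L = (L ∘ₗ B') ∘ₗ B := by
    ext1 A
    simp [h₂]
  exact this ▸ .comp hcomp hB

theorem theoremA (m n : ℕ) (hmn : (m = n ∧ 3 ≤ n) ∨ (m ≠ n ∧ 2 ≤ m ∧ 2 ≤ n))
    (L : Matrix (Fin m) (Fin n) ℝ →ₗ[ℝ] Matrix (Fin m) (Fin n) ℝ) :
    List.TFAE [
      L '' signRegular m n = signRegular m n,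
      L '' signRegularOfOrder m n 2 = signRegularOfOrder m n 2,
      IsCompositionOfBasic L] ∧
    List.TFAE [
      L '' strictlySignRegular m n = strictlySignRegular m n,
      L '' strictlySignRegularOfOrder m n 2 = strictlySignRegularOfOrder m n 2,
      IsCompositionOfBasic L] := by
  have hm : 2 ≤ m := by omega
  have hn : 2 ≤ n := by omega
  have hmn' : 3 ≤ m ∨ 3 ≤ n := by omega
  have h2 : 2 ≤ min m n := le_min hm hn
  have hSR : ∀ k, 2 ≤ k → k ≤ min m n →
      (L '' signRegularOfOrder m n k = signRegularOfOrder m n k ↔ IsCompositionOfBasic L) :=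
    fun k hk hk' => ⟨isCompositionOfBasic_of_image_eq hm hn hmn'
      ((strictlySignRegularOfOrder_anti hk').trans strictlySignRegularOfOrder_subset)
      (signRegularOfOrder_anti hk) fun B hB => hB.mapsTo_signRegularOfOrder k,
      fun h => h.image_eq fun B hB => hB.mapsTo_signRegularOfOrder k⟩
  have hSSR : ∀ k, 2 ≤ k → k ≤ min m n →
      (L '' strictlySignRegularOfOrder m n k = strictlySignRegularOfOrder m n k ↔
        IsCompositionOfBasic L) :=
    fun k hk hk' => ⟨isCompositionOfBasic_of_image_eq hm hn hmn'
      (strictlySignRegularOfOrder_anti hk')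
      ((strictlySignRegularOfOrder_anti hk).trans strictlySignRegularOfOrder_subset)
      fun B hB => hB.mapsTo_strictlySignRegularOfOrder k,
      fun h => h.image_eq fun B hB => hB.mapsTo_strictlySignRegularOfOrder k⟩
  constructor
  · tfae_have 1 ↔ 3 := hSR _ h2 le_rfl
    tfae_have 2 ↔ 3 := hSR 2 le_rfl h2
    tfae_finish
  · tfae_have 1 ↔ 3 := hSSR _ h2 le_rfl
    tfae_have 2 ↔ 3 := hSSR 2 le_rfl h2
    tfae_finish
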